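/- Let $\mathcal{X}$ be a measurable space with a probability measure $\mu$, let $a \le 0 < b$ and $z = \max\{|a|,|b|\}$, and let $\mathcal{F}$ be a class of measurable functions $f:\mathcal{X}\to[a,b]$ that contains the zero function. For $m\ge 1$, a sample $\mathcal{S}=(s_1,\dots,s_m)\in\mathcal{X}^m$ and signs $\boldsymbol\sigma=(\sigma_1,\dots,\sigma_m)\in\{-1,1\}^m$, define the $1$-draw Monte Carlo empirical Rademacher average $$\hat{\mathsf R}^1_m(\mathcal{F},\mathcal{S},\boldsymbol\sigma)=\sup_{f\in\mathcal{F}}\frac1m\sum_{i=1}^m\sigma_i f(s_i),$$ which is assumed to be a measurable function of $\mathcal{S}$ for every sample size and every choice of the signs. Let $\mathsf R(\mathcal{F},m)=\mathbb{E}_{\mathcal{S}}\,\mathbb{E}_{\boldsymbol\sigma}\big[\hat{\mathsf R}^1_m(\mathcal{F},\mathcal{S},\boldsymbol\sigma)\big]$ be the Rademacher complexity, where $s_1,\dots,s_m$ are i.i.d. with law $\mu$ and, independently of them, $\sigma_1,\dots,\sigma_m$ are independent and uniform on $\{-1,1\}$, and let $\sigma^2_{\mathcal{F}}=\sup_{f\in\mathcal{F}}\mathbb{E}_{x\sim\mu}[f(x)^2]$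 be the wimpy variance. Then for every $\delta\in(0,1)$, with probability at least $1-\delta$ over $(\mathcal{S},\boldsymbol\sigma)$, the following two inequalities both hold: $$\mathsf R(\mathcal{F},m)\le \hat{\mathsf R}^1_m(\mathcal{F},\mathcal{S},\boldsymbol\sigma)+\sqrt{\frac{2\big(2z\,\mathsf R(\mathcal{F},m)+\sigma^2_{\mathcal{F}}\big)\ln(1/\delta)}{m}}+\frac{z\ln(1/\delta)}{8m}$$ $$\le \hat{\mathsf R}^1_m(\mathcal{F},\mathcal{S},\boldsymbol\sigma)+\sqrt{\frac98\Big(\frac{2z\ln(1/\delta)}{m}\Big)^2+\frac{2\big(2z\,\hat{\mathsf R}^1_m(\mathcal{F},\mathcal{S},\boldsymbol\sigma)+\sigma^2_{\mathcal{F}}\big)\ln(1/\delta)}{m}}+\frac{17z\ln(1/\delta)}{8m}.$$ -/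

import Mathlib

open MeasureTheory

noncomputable section

instance : MeasurableSingletonClass ℤˣ where
  measurableSet_singleton u :=
    ⟨{(u : ℤ)}, MeasurableSet.of_discrete, by ext v; simp [Units.ext_iff]⟩

/-- The law of a Rademacher variable: `1` and `-1` with probability `1/2` each
(the type `ℤˣ` has exactly the two elements `1` and `-1`). -/
def rademacher : Measure ℤˣ :=
  (2 : ENNReal)⁻¹ • (Measure.dirac 1 + Measure.dirac (-1))

instance : IsProbabilityMeasure rademacher := by
  constructor
  simp [rademacher, ENNReal.inv_two_add_inv_two]

/-- The law of an `n × m` matrix of independent Rademacher variables. -/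
def signLaw (n m : ℕ) : Measure (Fin n → Fin m → ℤˣ) :=
  Measure.pi fun _ => Measure.pi fun _ => rademacher

/-- The law of a sample of `m` points drawn i.i.d. from `μ`. -/
def sampleLaw {X : Type*} [MeasurableSpace X] (μ : Measure X) (m : ℕ) : Measure (Fin m → X) :=
  Measure.pi fun _ => μ

/-- The `n`-Monte Carlo Empirical Rademacher Average of the class `F` on the sample `S`. -/
def mcera {X : Type*} {n m : ℕ} (F : Set (X → ℝ)) (S : Fin m → X)
    (σ : Fin n → Fin m → ℤˣ) : ℝ :=
  (1 / (n : ℝ)) * ∑ j, ⨆ f : F, (1 / (m : ℝ)) * ∑ i, ((σ j i : ℤ) : ℝ) * (f : X → ℝ) (S i)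

/-- The Empirical Rademacher Average, the expectation of the `n`-MCERA over the signs.
By `era_eq` below it is the same number for every `n ≥ 1`, so it is defined with `n = 1`. -/
def era {X : Type*} {m : ℕ} (F : Set (X → ℝ)) (S : Fin m → X) : ℝ :=
  ∫ σ, mcera F S σ ∂(signLaw 1 m)

/-- The Rademacher Complexity. -/
def rademacherComplexity {X : Type*} [MeasurableSpace X] (μ : Measure X) (F : Set (X → ℝ))
    (m : ℕ) : ℝ :=
  ∫ S, era F S ∂(sampleLaw μ m)

/-- The wimpy variance `sup_{f ∈ F} E[f²]`. -/
def wimpyVariance {X : Type*} [MeasurableSpace X] (μ : Measure X) (F : Set (X → ℝ)) : ℝ :=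
  ⨆ f : F, ∫ x, (f : X → ℝ) x ^ 2 ∂μ

theorem era_eq {X : Type*} {n m : ℕ} (hn : 0 < n) (F : Set (X → ℝ)) (S : Fin m → X) :
    ∫ σ, mcera F S σ ∂(signLaw n m) = era F S := by
  have key : ∀ k : ℕ, 0 < k → ∫ σ, mcera F S σ ∂(signLaw k m) =
      ∫ τ : Fin m → ℤˣ, (⨆ f : F, (1 / (m : ℝ)) * ∑ i, ((τ i : ℤ) : ℝ) * (f : X → ℝ) (S i))
        ∂(Measure.pi fun _ => rademacher) := by
    intro k hk
    have hk' : (k : ℝ) ≠ 0 := by positivity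
    simp only [mcera, signLaw]
    rw [integral_const_mul, integral_finsetSum]
    · have h : ∀ j : Fin k, ∫ σ : Fin k → Fin m → ℤˣ,
          (⨆ f : F, (1 / (m : ℝ)) * ∑ i, ((σ j i : ℤ) : ℝ) * (f : X → ℝ) (S i))
            ∂(Measure.pi fun _ => Measure.pi fun _ => rademacher) =
          ∫ τ : Fin m → ℤˣ, (⨆ f : F, (1 / (m : ℝ)) * ∑ i, ((τ i : ℤ) : ℝ) * (f : X → ℝ) (S i))
            ∂(Measure.pi fun _ => rademacher) := by
        intro j
        exact integral_comp_eval (μ := fun _ : Fin k => Measure.pi fun _ : Fin m => rademacher)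
          (f := fun τ : Fin m → ℤˣ =>
            ⨆ f : F, (1 / (m : ℝ)) * ∑ i, ((τ i : ℤ) : ℝ) * (f : X → ℝ) (S i))
          (Measurable.of_discrete.aestronglyMeasurable)
      simp only [h, Finset.sum_const, Finset.card_univ, Fintype.card_fin, nsmul_eq_mul]
      field_simp
    · intro j _
      exact Integrable.of_finite
  rw [key n hn, era, key 1 one_pos]

end

/-!
Multiplied by `m / z`, the Monte Carlo average becomes `Z = sup_f ∑ᵢ σᵢ f(sᵢ) / z`, a nonnegative
function of `m` independent signed points. Let `Zᵢ` be the supremum without the `i`-th point. Then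
`|Z - Zᵢ| ≤ 1` and `∑ᵢ (Z - Zᵢ) ≤ Z`, and `Z - Zᵢ` dominates, up to an arbitrarily small error,
`σᵢ f(sᵢ) / z` for some `f` which does not depend on the `i`-th point.

By subadditivity of the entropy, the entropy of `e^{-l Z}` is controlled one coordinate at a time.
There the linear terms of `f` cancel because `σᵢ` is symmetric, so that only its variance enters,
and `∑ᵢ (Z - Zᵢ) ≤ Z` sums the coordinate bounds. The outcome is a differential inequality for the
cumulant generating function `G` of `-Z`; with the integrating factor `e^l` for `G(l) / l` it gives
`G(l) + l E[Z] ≤ l² v / 2` with `v = 2 E[Z] + m σ²_F / z²`, for `l ≤ E[Z] / v`. Chernoff's bound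
with `l = √(2 t / v)`, `t = ln(1/δ)`, shows `E[Z] ≤ Z + √(2 v t)` with probability at least `1 - δ`;
when this `l` is not admissible, the inequality holds already because `0 ≤ Z`. The second inequality
follows by completing the square in `√(2 (2 z R + σ²_F) t / m)`.
-/

section Entropy

/-- The entropy `E[Y log Y] - E[Y] log E[Y]` of a nonnegative function `Y`. It is subadditive over
product measures, and at `Y = exp (l X)` it is a differential expression in the cumulant generating
function of `X`. -/
noncomputable def entropy {Ω : Type*} [MeasurableSpace Ω] (P : Measure Ω) (Y : Ω → ℝ) : ℝ :=
  ∫ ω, Y ω * Real.log (Y ω) ∂P - (∫ ω, Y ω ∂P) * Real.log (∫ ω, Y ω ∂P)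

variable {Ω Ω' : Type*} [MeasurableSpace Ω] [MeasurableSpace Ω'] {P : Measure Ω} {Q : Measure Ω'}

theorem entropy_le_integral_mul_log_sub {Y : Ω → ℝ} {u : ℝ} (hY : 0 ≤ ∫ ω, Y ω ∂P) (hu : 0 < u) :
    entropy P Y ≤
      ∫ ω, Y ω * Real.log (Y ω) ∂P - (∫ ω, Y ω ∂P) * Real.log u - ∫ ω, Y ω ∂P + u := by
  unfold entropy
  set M := ∫ ω, Y ω ∂P
  suffices M * Real.log u - M * Real.log M ≤ u - M by linarith
  rcases hY.eq_or_lt with hM | hM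
  · rw [← hM]; linarith
  · calc M * Real.log u - M * Real.log M = M * Real.log (u / M) := by
          rw [Real.log_div hu.ne' hM.ne']; ring
      _ ≤ M * (u / M - 1) := by gcongr; exact Real.log_le_sub_one_of_pos (by positivity)
      _ = u - M := by field_simp

theorem integral_pos_of_forall_pos [NeZero P] {Y : Ω → ℝ} (hY : ∀ ω, 0 < Y ω)
    (hi : Integrable Y P) : 0 < ∫ ω, Y ω ∂P := by
  rw [integral_pos_iff_support_of_nonneg (fun ω => (hY ω).le) hi,
    Function.support_eq_univ fun ω => (hY ω).ne']
  exact NeZero.pos _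

theorem integral_mul_log_le_entropy_add [NeZero P] {Y T : Ω → ℝ} (hY : ∀ ω, 0 < Y ω)
    (hT : ∀ ω, 0 < T ω) (hiY : Integrable Y P) (hiT : Integrable T P)
    (hiYY : Integrable (fun ω => Y ω * Real.log (Y ω)) P)
    (hiYT : Integrable (fun ω => Y ω * Real.log (T ω)) P) :
    ∫ ω, Y ω * Real.log (T ω) ∂P ≤ entropy P Y + (∫ ω, Y ω ∂P) * Real.log (∫ ω, T ω ∂P) := by
  have hM := integral_pos_of_forall_pos hY hiY
  have hN := integral_pos_of_forall_pos hT hiT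
  unfold entropy
  set M := ∫ ω, Y ω ∂P with hMdef
  set N := ∫ ω, T ω ∂P with hNdef
  have pointwise (ω) : Y ω * Real.log (T ω) ≤
      Y ω * Real.log (Y ω) + Y ω * (Real.log N - Real.log M - 1) + T ω * (M / N) := by
    have hy := hY ω
    have ht := hT ω
    calc Y ω * Real.log (T ω)
        = Y ω * Real.log (Y ω) + Y ω * (Real.log N - Real.log M)
            + Y ω * Real.log (T ω * M / (Y ω * N)) := by
          rw [Real.log_div (by positivity) (by positivity), Real.log_mul ht.ne' hM.ne',
            Real.log_mul hy.ne' hN.ne']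
          ring
      _ ≤ Y ω * Real.log (Y ω) + Y ω * (Real.log N - Real.log M)
            + Y ω * (T ω * M / (Y ω * N) - 1) := by
          gcongr
          exact Real.log_le_sub_one_of_pos (by positivity)
      _ = _ := by field_simp; ring
  have h := integral_mono hiYT ((hiYY.add (hiY.mul_const _)).add (hiT.mul_const _)) pointwise
  rw [integral_add' (hiYY.add (hiY.mul_const _)) (hiT.mul_const _),
    integral_add' hiYY (hiY.mul_const _), integral_mul_const, integral_mul_const,
    ← hMdef, ← hNdef, mul_div_cancel₀ M hN.ne'] at h
  linarith

theorem integrable_mul_log_of_mem_Icc {Y T : Ω → ℝ} {c C : ℝ} (hc : 0 < c) (hY : Integrable Y P)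
    (hT : Measurable T) (hbT : ∀ ω, T ω ∈ Set.Icc c C) :
    Integrable (fun ω => Y ω * Real.log (T ω)) P := by
  refine hY.mul_bdd (c := max |Real.log c| |Real.log C|) hT.log.aestronglyMeasurable
    (ae_of_all _ fun ω => ?_)
  obtain ⟨hcT, hTC⟩ := hbT ω
  exact abs_le_max_abs_abs (Real.log_le_log hc hcT) (Real.log_le_log (hc.trans_le hcT) hTC)

section Prod

variable [IsProbabilityMeasure P] [IsProbabilityMeasure Q] {Y : Ω × Ω' → ℝ} {c C : ℝ}

theorem integral_prodMk_mem_Icc (hY : Measurable Y) (hb : ∀ p, Y p ∈ Set.Icc c C) (a : Ω) :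
    ∫ b, Y (a, b) ∂Q ∈ Set.Icc c C :=
  (convex_Icc c C).integral_mem isClosed_Icc (ae_of_all _ fun b => hb (a, b))
    (.of_mem_Icc c C (hY.comp measurable_prodMk_left).aemeasurable (ae_of_all _ fun b => hb (a, b)))

theorem integrable_entropy_prodMk (hc : 0 < c) (hY : Measurable Y)
    (hb : ∀ p, Y p ∈ Set.Icc c C) : Integrable (fun a => entropy Q fun b => Y (a, b)) P := by
  have hiY : Integrable Y (P.prod Q) := .of_mem_Icc c C hY.aemeasurable (ae_of_all _ hb)
  exact (integrable_mul_log_of_mem_Icc hc hiY hY hb).integral_prod_left.sub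
    (integrable_mul_log_of_mem_Icc hc hiY.integral_prod_left
      hY.stronglyMeasurable.integral_prod_right'.measurable (integral_prodMk_mem_Icc hY hb))

theorem entropy_prod_eq (hc : 0 < c) (hY : Measurable Y) (hb : ∀ p, Y p ∈ Set.Icc c C) :
    entropy (P.prod Q) Y =
      ∫ a, entropy Q (fun b => Y (a, b)) ∂P + entropy P fun a => ∫ b, Y (a, b) ∂Q := by
  have hiY : Integrable Y (P.prod Q) := .of_mem_Icc c C hY.aemeasurable (ae_of_all _ hb)
  have hiYY := integrable_mul_log_of_mem_Icc hc hiY hY hb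
  have hiTT := integrable_mul_log_of_mem_Icc hc hiY.integral_prod_left
    hY.stronglyMeasurable.integral_prod_right'.measurable (integral_prodMk_mem_Icc (Q := Q) hY hb)
  simp only [entropy]
  rw [integral_sub hiYY.integral_prod_left hiTT, integral_prod _ hiYY, integral_prod _ hiY]
  ring

theorem entropy_integral_le (hc : 0 < c) (hY : Measurable Y) (hb : ∀ p, Y p ∈ Set.Icc c C) :
    entropy P (fun a => ∫ b, Y (a, b) ∂Q) ≤ ∫ b, entropy P (fun a => Y (a, b)) ∂Q := by
  set T : Ω → ℝ := fun a => ∫ b, Y (a, b) ∂Q with hT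
  have hTm : Measurable T := hY.stronglyMeasurable.integral_prod_right'.measurable
  have hbT : ∀ a, T a ∈ Set.Icc c C := integral_prodMk_mem_Icc hY hb
  have hiY : Integrable Y (P.prod Q) := .of_mem_Icc c C hY.aemeasurable (ae_of_all _ hb)
  have hiT : Integrable T P := hiY.integral_prod_left
  have hiYT : Integrable (fun p => Y p * Real.log (T p.1)) (P.prod Q) :=
    integrable_mul_log_of_mem_Icc hc hiY (hTm.comp measurable_fst) fun p => hbT p.1
  have hient : Integrable (fun b => entropy P fun a => Y (a, b)) Q :=
    integrable_entropy_prodMk (P := Q) (Q := P) hc (hY.comp measurable_swap) fun p => hb p.swap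
  have variational (b) : ∫ a, Y (a, b) * Real.log (T a) ∂P ≤
      entropy P (fun a => Y (a, b)) + (∫ a, Y (a, b) ∂P) * Real.log (∫ a, T a ∂P) := by
    have hYb : Measurable fun a => Y (a, b) := hY.comp measurable_prodMk_right
    have hiYb : Integrable (fun a => Y (a, b)) P :=
      .of_mem_Icc c C hYb.aemeasurable (ae_of_all _ fun a => hb (a, b))
    exact integral_mul_log_le_entropy_add (fun a => hc.trans_le (hb (a, b)).1)
      (fun a => hc.trans_le (hbT a).1) hiYb hiT
      (integrable_mul_log_of_mem_Icc hc hiYb hYb fun a => hb (a, b))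
      (integrable_mul_log_of_mem_Icc hc hiYb hTm hbT)
  have htotal : ∫ b, ∫ a, Y (a, b) ∂P ∂Q = ∫ a, T a ∂P :=
    (integral_prod_symm _ hiY).symm.trans (integral_prod _ hiY)
  have hTT : ∫ a, T a * Real.log (T a) ∂P = ∫ b, ∫ a, Y (a, b) * Real.log (T a) ∂P ∂Q := by
    rw [← integral_prod_symm _ hiYT, integral_prod _ hiYT]
    simp only [integral_mul_const, hT]
  have h := integral_mono hiYT.integral_prod_right
    (hient.add (hiY.integral_prod_right.mul_const _)) variational
  rw [integral_add' hient (hiY.integral_prod_right.mul_const _), integral_mul_const, htotal,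
    ← hTT] at h
  rw [entropy]
  linarith

theorem entropy_prod_le (hc : 0 < c) (hY : Measurable Y) (hb : ∀ p, Y p ∈ Set.Icc c C) :
    entropy (P.prod Q) Y ≤
      ∫ b, entropy P (fun a => Y (a, b)) ∂Q + ∫ a, entropy Q (fun b => Y (a, b)) ∂P := by
  rw [entropy_prod_eq hc hY hb, add_comm]
  gcongr
  exact entropy_integral_le hc hY hb

end Prod

end Entropy

section Pi

variable {ι : Type*} [Fintype ι] [DecidableEq ι] {Ω : ι → Type*} [∀ i, MeasurableSpace (Ω i)]
  {P : ∀ i, Measure (Ω i)} [∀ i, IsProbabilityMeasure (P i)]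

theorem measurePreserving_update (i : ι) :
    MeasurePreserving (fun p : (∀ j, Ω j) × Ω i => Function.update p.1 i p.2)
      ((Measure.pi P).prod (P i)) (Measure.pi P) := by
  refine ⟨measurable_update', (Measure.pi_eq fun s hs => ?_).symm⟩
  have hpre : (fun p : (∀ j, Ω j) × Ω i => Function.update p.1 i p.2) ⁻¹' Set.univ.pi s =
      Set.univ.pi (Function.update s i Set.univ) ×ˢ s i := by
    ext ⟨ω, x⟩
    simp only [Set.mem_preimage, Set.mem_univ_pi, Set.mem_prod]
    rw [Function.forall_update_iff ω fun j y => y ∈ s j,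
      Function.forall_update_iff s fun j t => ω j ∈ t]
    simp [and_comm]
  rw [Measure.map_apply measurable_update' (.univ_pi hs), hpre, Measure.prod_prod, Measure.pi_pi,
    ← Finset.prod_erase_mul Finset.univ _ (Finset.mem_univ i),
    ← Finset.prod_erase_mul Finset.univ (fun j => P j (s j)) (Finset.mem_univ i)]
  simp only [Function.update_self, measure_univ, mul_one]
  congr 1
  exact Finset.prod_congr rfl fun j hj => by rw [Function.update_of_ne (Finset.ne_of_mem_erase hj)]

theorem integral_integral_update {f : (∀ i, Ω i) → ℝ} (hf : Integrable f (Measure.pi P)) (i : ι) :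
    ∫ ω, ∫ x, f (Function.update ω i x) ∂P i ∂Measure.pi P = ∫ ω, f ω ∂Measure.pi P := by
  have hmp := measurePreserving_update (P := P) i
  have hf' : AEStronglyMeasurable f
      (((Measure.pi P).prod (P i)).map fun p => Function.update p.1 i p.2) :=
    hmp.map_eq.symm ▸ hf.aestronglyMeasurable
  rw [← integral_prod (fun p : (∀ j, Ω j) × Ω i => f (Function.update p.1 i p.2))
    (hmp.integrable_comp_of_integrable hf), ← integral_map hmp.aemeasurable hf', hmp.map_eq]

theorem integrable_entropy_update {Y : (∀ i, Ω i) → ℝ} {c C : ℝ} (hc : 0 < c) (hY : Measurable Y)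
    (hb : ∀ ω, Y ω ∈ Set.Icc c C) (i : ι) :
    Integrable (fun ω => entropy (P i) fun x => Y (Function.update ω i x)) (Measure.pi P) :=
  integrable_entropy_prodMk hc (hY.comp measurable_update') fun p => hb (Function.update p.1 i p.2)

end Pi

section PiFin

variable {n : ℕ}

section Cons

variable {Ω : Fin (n + 1) → Type*} [∀ i, MeasurableSpace (Ω i)] {P : ∀ i, Measure (Ω i)}
  [∀ i, IsProbabilityMeasure (P i)]

theorem measurePreserving_cons :
    MeasurePreserving (fun p : Ω 0 × (∀ i : Fin n, Ω i.succ) => (Fin.cons p.1 p.2 : ∀ i, Ω i))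
      ((P 0).prod (Measure.pi fun i => P i.succ)) (Measure.pi P) := by
  have hcons : (fun p : Ω 0 × (∀ i : Fin n, Ω i.succ) => (Fin.cons p.1 p.2 : ∀ i, Ω i)) =
      (MeasurableEquiv.piFinSuccAbove Ω 0).symm := funext fun p => (Fin.insertNth_zero p.1 p.2).symm
  rw [hcons]
  exact (measurePreserving_piFinSuccAbove P 0).symm

theorem integral_pi_succ (f : (∀ i, Ω i) → ℝ) :
    ∫ ω, f ω ∂Measure.pi P =
      ∫ p : Ω 0 × (∀ i : Fin n, Ω i.succ), f (Fin.cons p.1 p.2)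
        ∂(P 0).prod (Measure.pi fun i => P i.succ) := by
  rw [← (measurePreserving_piFinSuccAbove P 0).symm.integral_comp']
  exact integral_congr_ae (ae_of_all _ fun p => congrArg f (Fin.insertNth_zero p.1 p.2))

theorem integral_entropy_update_zero (Y : (∀ i, Ω i) → ℝ) :
    ∫ ω, entropy (P 0) (fun x => Y (Function.update ω 0 x)) ∂Measure.pi P =
      ∫ b : ∀ i : Fin n, Ω i.succ, entropy (P 0) (fun a => Y (Fin.cons a b))
        ∂Measure.pi fun i => P i.succ := by
  simp only [integral_pi_succ, Fin.update_cons_zero]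
  rw [integral_fun_snd fun b => entropy (P 0) fun x => Y (Fin.cons x b), probReal_univ, one_smul]

theorem integrable_entropy_cons_update {Y : (∀ i, Ω i) → ℝ} {c C : ℝ} (hc : 0 < c)
    (hY : Measurable Y) (hb : ∀ ω, Y ω ∈ Set.Icc c C) (i : Fin n) :
    Integrable (fun p : Ω 0 × (∀ i : Fin n, Ω i.succ) =>
        entropy (P i.succ) fun x => Y (Fin.cons p.1 (Function.update p.2 i x)))
      ((P 0).prod (Measure.pi fun i => P i.succ)) := by
  simpa only [Function.comp_def, Fin.cons_update] using
    measurePreserving_cons.integrable_comp_of_integrable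
      (integrable_entropy_update hc hY hb i.succ)

theorem integral_entropy_update_succ {Y : (∀ i, Ω i) → ℝ} {c C : ℝ} (hc : 0 < c)
    (hY : Measurable Y) (hb : ∀ ω, Y ω ∈ Set.Icc c C) (i : Fin n) :
    ∫ ω, entropy (P i.succ) (fun x => Y (Function.update ω i.succ x)) ∂Measure.pi P =
      ∫ a, ∫ b : ∀ i : Fin n, Ω i.succ,
        entropy (P i.succ) (fun x => Y (Fin.cons a (Function.update b i x)))
          ∂(Measure.pi fun i => P i.succ) ∂P 0 := by
  rw [integral_pi_succ, ← integral_prod _ (integrable_entropy_cons_update hc hY hb i)]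
  simp only [Fin.cons_update]

end Cons

theorem entropy_pi_le {Ω : Fin n → Type*} [∀ i, MeasurableSpace (Ω i)]
    {P : ∀ i, Measure (Ω i)} [∀ i, IsProbabilityMeasure (P i)] {Y : (∀ i, Ω i) → ℝ} {c C : ℝ}
    (hc : 0 < c) (hY : Measurable Y) (hb : ∀ ω, Y ω ∈ Set.Icc c C) :
    entropy (Measure.pi P) Y ≤
      ∑ i, ∫ ω, entropy (P i) (fun x => Y (Function.update ω i x)) ∂Measure.pi P := by
  induction n with
  | zero =>
    have hconst : Y = fun _ => Y default := funext fun ω => by rw [Subsingleton.elim ω default]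
    rw [hconst]
    simp [entropy]
  | succ n ih =>
    set Q : Measure (∀ i : Fin n, Ω i.succ) := Measure.pi fun i => P i.succ
    have hY' : Measurable fun p : Ω 0 × (∀ i : Fin n, Ω i.succ) => Y (Fin.cons p.1 p.2) :=
      hY.comp (measurePreserving_cons (P := P)).measurable
    have hint (i : Fin n) := (integrable_entropy_cons_update (P := P) hc hY hb i).integral_prod_left
    calc entropy (Measure.pi P) Y = entropy ((P 0).prod Q) fun p => Y (Fin.cons p.1 p.2) := by
          simp only [entropy, integral_pi_succ, Q]
      _ ≤ ∫ b, entropy (P 0) (fun a => Y (Fin.cons a b)) ∂Q +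
            ∫ a, entropy Q (fun b => Y (Fin.cons a b)) ∂P 0 := entropy_prod_le hc hY' fun p => hb _
      _ ≤ ∫ b, entropy (P 0) (fun a => Y (Fin.cons a b)) ∂Q + ∫ a, ∑ i : Fin n, ∫ b,
            entropy (P i.succ) (fun x => Y (Fin.cons a (Function.update b i x))) ∂Q ∂P 0 := by
          gcongr
          · exact integrable_entropy_prodMk hc hY' fun p => hb _
          · exact integrable_finsetSum _ fun i _ => hint i
          · intro a
            exact ih (hY'.comp measurable_prodMk_left) fun b => hb _
      _ = _ := by
          rw [integral_finsetSum _ fun i _ => hint i, Fin.sum_univ_succ,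
            integral_entropy_update_zero]
          simp only [integral_entropy_update_succ hc hY hb, Q]

theorem entropy_pi_le_sum_integral {Ω : Fin n → Type*} [∀ i, MeasurableSpace (Ω i)]
    {P : ∀ i, Measure (Ω i)} [∀ i, IsProbabilityMeasure (P i)] {Y : (∀ i, Ω i) → ℝ} {c C : ℝ}
    (hc : 0 < c) (hY : Measurable Y) (hb : ∀ ω, Y ω ∈ Set.Icc c C)
    {D : Fin n → (∀ i, Ω i) → ℝ} (hD : ∀ i, Integrable (D i) (Measure.pi P))
    (hle : ∀ i ω, entropy (P i) (fun x => Y (Function.update ω i x)) ≤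
      ∫ x, D i (Function.update ω i x) ∂P i) :
    entropy (Measure.pi P) Y ≤ ∑ i, ∫ ω, D i ω ∂Measure.pi P := by
  refine (entropy_pi_le hc hY hb).trans (Finset.sum_le_sum fun i _ => ?_)
  rw [← integral_integral_update (hD i) i]
  exact integral_mono (integrable_entropy_update hc hY hb i)
    ((measurePreserving_update i).integrable_comp_of_integrable (hD i)).integral_prod_left (hle i)

end PiFin

section ElementaryBounds

open Real

/-- The function `y ↦ (1 - l + l y) e^{-l y}` of the increment `y` of `Z` caused by one coordinate.
If its mean over that coordinate is at least `(1 - l) q`, then the entropy of `e^{-l Z}` in that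
coordinate is at most the mean of `e^{-l Z} (-log q + l² y / (1 - l))`. -/
noncomputable def tiltedExp (l y : ℝ) : ℝ := (1 - l + l * y) * exp (-(l * y))

/-- A coefficient `K` for which the average of `tiltedExp l` over the increments `y` and `-y` is at
least `(1 - l) (1 - K y²)` when `|y| ≤ 1` and `0 ≤ l ≤ 1/2`. -/
noncomputable def varianceLoss (l : ℝ) : ℝ := l ^ 2 * (2 + 2 * l + l ^ 2) / (4 * (1 - l))

variable {l : ℝ}

theorem continuous_tiltedExp (l : ℝ) : Continuous (tiltedExp l) := by
  unfold tiltedExp; fun_prop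

theorem monotoneOn_tiltedExp (l : ℝ) : MonotoneOn (tiltedExp l) (Set.Iic 1) := by
  have hderiv (y : ℝ) : HasDerivAt (tiltedExp l) (l ^ 2 * (1 - y) * exp (-(l * y))) y := by
    have hlin : HasDerivAt (fun y => l * y) l y := by simpa using (hasDerivAt_id y).const_mul l
    exact ((hlin.const_add (1 - l)).mul hlin.neg.exp).congr_deriv
      (by simp only [Pi.neg_apply]; ring)
  refine monotoneOn_of_deriv_nonneg (convex_Iic 1) (continuous_tiltedExp l).continuousOn
    (fun y _ => (hderiv y).differentiableAt.differentiableWithinAt) fun y hy => ?_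
  rw [interior_Iic, Set.mem_Iio] at hy
  rw [(hderiv y).deriv]
  have : 0 < 1 - y := by linarith
  positivity

theorem tiltedExp_sub_two_mul_le {y d ε : ℝ} (hl : l ∈ Set.Icc (0 : ℝ) (1 / 2)) (hy : |y| ≤ 1)
    (hε : ε ∈ Set.Icc (0 : ℝ) 1) (hyd : y - ε ≤ d) (hd : d ≤ 1) :
    tiltedExp l y - 2 * ε ≤ tiltedExp l d := by
  obtain ⟨hl0, hl1⟩ := hl
  obtain ⟨hε0, hε1⟩ := hε
  have := (abs_le.1 hy).1
  have := (abs_le.1 hy).2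
  have hweight : 0 ≤ 1 - l + l * y := by nlinarith
  have hexp : exp (-(l * (y - ε))) ≤ 3 :=
    (exp_le_exp.2 (by nlinarith)).trans (exp_one_lt_d9.le.trans (by norm_num))
  calc tiltedExp l y - 2 * ε
      ≤ (1 - l + l * y) * exp (-(l * (y - ε))) - l * ε * exp (-(l * (y - ε))) := by
        have hmono : exp (-(l * y)) ≤ exp (-(l * (y - ε))) := exp_le_exp.2 (by nlinarith)
        have hcorrection : l * ε * exp (-(l * (y - ε))) ≤ 1 / 2 * ε * 3 := by gcongr
        rw [tiltedExp]
        linarith [mul_le_mul_of_nonneg_left hmono hweight]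
    _ = tiltedExp l (y - ε) := by unfold tiltedExp; ring
    _ ≤ tiltedExp l d := monotoneOn_tiltedExp l (hyd.trans hd) hd hyd

theorem mul_sinh_le {x : ℝ} (hx : |x| ≤ 1 / 2) : x * sinh x ≤ x ^ 2 + x ^ 4 / 4 := by
  have hpos := Real.exp_bound (x := x) (by linarith) (n := 4) (by norm_num)
  have hneg := Real.exp_bound (x := -x) (by rw [abs_neg]; linarith) (n := 4) (by norm_num)
  norm_num [Finset.sum_range_succ, Nat.factorial] at hpos hneg
  have hremainder : |sinh x - (x + x ^ 3 / 6)| ≤ x ^ 4 * (5 / 96) := by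
    rw [sinh_eq, abs_le]
    have hodd : (-x) ^ 3 = -x ^ 3 := by ring
    rw [Even.pow_abs (by decide), abs_le] at hpos hneg
    rw [hodd] at hneg
    constructor <;> linarith
  have h : x * (sinh x - (x + x ^ 3 / 6)) ≤ 1 / 2 * (x ^ 4 * (5 / 96)) :=
    (le_abs_self _).trans (by rw [abs_mul]; gcongr)
  nlinarith [pow_two_nonneg (x ^ 2)]

theorem one_add_sq_div_two_le_cosh (x : ℝ) : 1 + x ^ 2 / 2 ≤ cosh x := by
  have hdouble : cosh x = 1 + 2 * sinh (x / 2) ^ 2 := by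
    have h := cosh_two_mul (x / 2)
    rw [mul_div_cancel₀ x two_ne_zero, cosh_sq] at h
    linarith
  have hsinh : (x / 2) ^ 2 ≤ sinh (x / 2) ^ 2 := sq_le_sq.2 (by
    rw [abs_sinh]
    exact self_le_sinh_iff.2 (abs_nonneg _))
  linarith

theorem one_sub_mul_varianceLoss (hl : 1 - l ≠ 0) :
    (1 - l) * varianceLoss l = l ^ 2 / 2 + l ^ 3 / 2 + l ^ 4 / 4 := by
  rw [varianceLoss]
  field_simp
  ring

theorem varianceLoss_nonneg (hl0 : 0 ≤ l) (hl1 : l < 1) : 0 ≤ varianceLoss l := by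
  have : 0 < 1 - l := by linarith
  unfold varianceLoss
  positivity

theorem varianceLoss_lt_one (hl0 : 0 ≤ l) (hl1 : l ≤ 1 / 2) : varianceLoss l < 1 := by
  rw [varianceLoss, div_lt_one (by linarith)]
  nlinarith [mul_nonneg hl0 (sub_nonneg.2 hl1), pow_nonneg hl0 3]

theorem one_sub_mul_le_tiltedExp_add_neg {y : ℝ} (hl : l ∈ Set.Icc (0 : ℝ) (1 / 2))
    (hy : |y| ≤ 1) :
    (1 - l) * (1 - varianceLoss l * y ^ 2) ≤ (tiltedExp l y + tiltedExp l (-y)) / 2 := by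
  obtain ⟨hl0, hl1⟩ := hl
  have hly : |l * y| ≤ 1 / 2 := by rw [abs_mul, abs_of_nonneg hl0]; nlinarith [abs_nonneg y]
  have hy2 : y ^ 2 ≤ 1 := (sq_le_one_iff_abs_le_one y).2 hy
  have hloss := one_sub_mul_varianceLoss (sub_ne_zero.2 (by linarith : (1 : ℝ) ≠ l))
  calc (1 - l) * (1 - varianceLoss l * y ^ 2)
      = (1 - l) * (1 + (l * y) ^ 2 / 2) - ((l * y) ^ 2 + l ^ 4 * y ^ 2 / 4) := by
        rw [mul_sub, ← mul_assoc, hloss]; ring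
    _ ≤ (1 - l) * cosh (l * y) - l * y * sinh (l * y) := by
        have hquartic : (l * y) ^ 4 ≤ l ^ 4 * y ^ 2 := by
          rw [mul_pow]
          exact mul_le_mul_of_nonneg_left (by nlinarith [sq_nonneg y]) (by positivity)
        gcongr
        · linarith
        · exact one_add_sq_div_two_le_cosh _
        · linarith [mul_sinh_le hly]
    _ = (tiltedExp l y + tiltedExp l (-y)) / 2 := by
        simp only [tiltedExp, cosh_eq, sinh_eq, mul_neg, neg_neg]; ring

theorem neg_log_one_sub_mul_le {K s : ℝ} (hK0 : 0 ≤ K) (hK1 : K < 1) (hs0 : 0 ≤ s)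
    (hs1 : s ≤ 1) : -log (1 - K * s) ≤ s * (K / (1 - K)) := by
  have hKs : K * s ≤ K := mul_le_of_le_one_right hK0 hs1
  calc -log (1 - K * s) ≤ (1 - K * s)⁻¹ - 1 := by
        linarith [one_sub_inv_le_log_of_pos (x := 1 - K * s) (by linarith)]
    _ = K * s / (1 - K * s) := by
      have : 1 - K * s ≠ 0 := by linarith
      field_simp
      ring
    _ ≤ K * s / (1 - K) := by gcongr
    _ = s * (K / (1 - K)) := by ring

theorem one_sub_mul_varianceLoss_div_le (hl : l ∈ Set.Icc (0 : ℝ) (1 / 2)) :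
    (1 - l) * (varianceLoss l / (1 - varianceLoss l)) ≤
      l ^ 2 * (1 / 2 + l / 2 + 3 / 2 * l ^ 2 + 5 / 2 * l ^ 3 + l ^ 4 / 2) := by
  obtain ⟨hl0, hl1⟩ := hl
  have hl2 : 0 < 1 - l := by linarith
  have hK : 0 < 1 - varianceLoss l := sub_pos.2 (varianceLoss_lt_one hl0 hl1)
  have hmargin : 0 ≤ l ^ 4 / 8 *
      (8 + 6 * l - 25 * l ^ 2 - 21 * l ^ 3 - 15 * l ^ 4 - 7 * l ^ 5 - l ^ 6) := by
    have h2 : l ^ 2 ≤ (1 / 2) ^ 2 := by gcongr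
    have h3 : l ^ 3 ≤ (1 / 2) ^ 3 := by gcongr
    have h4 : l ^ 4 ≤ (1 / 2) ^ 4 := by gcongr
    have h5 : l ^ 5 ≤ (1 / 2) ^ 5 := by gcongr
    have h6 : l ^ 6 ≤ (1 / 2) ^ 6 := by gcongr
    have : 0 ≤ 8 + 6 * l - 25 * l ^ 2 - 21 * l ^ 3 - 15 * l ^ 4 - 7 * l ^ 5 - l ^ 6 := by
      norm_num at h2 h3 h4 h5 h6
      nlinarith
    positivity
  rw [mul_div_assoc', div_le_iff₀ hK]
  refine le_of_mul_le_mul_left ?_ hl2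
  have hloss := one_sub_mul_varianceLoss hl2.ne'
  linear_combination hmargin +
    (1 - l + l ^ 2 * (1 / 2 + l / 2 + 3 / 2 * l ^ 2 + 5 / 2 * l ^ 3 + l ^ 4 / 2)) * hloss

theorem herbst_bound_le {E n : ℝ} (hE : 0 ≤ E) (hl : l ∈ Set.Icc (0 : ℝ) (1 / 2))
    (hlE : l * (2 * E + n) ≤ E) :
    l * (exp (-l) * -E + n * (l / 2 + l ^ 3 / 2 + l ^ 4 / 2)) + l * E ≤
      l ^ 2 * (2 * E + n) / 2 := by
  obtain ⟨hl0, hl1⟩ := hl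
  have hexp := Real.exp_bound (x := -l) (by rw [abs_neg, abs_of_nonneg hl0]; linarith) (n := 3)
    (by norm_num)
  norm_num [Finset.sum_range_succ, Nat.factorial, abs_of_nonneg hl0] at hexp
  have hexp' : 1 - l + l ^ 2 / 2 - 2 / 9 * l ^ 3 ≤ exp (-l) := by linarith [(abs_le.1 hexp).1]
  have hE' : l * (1 - l + l ^ 2 / 2 - 2 / 9 * l ^ 3) * E ≤ l * exp (-l) * E := by gcongr
  have hn' : l * n * (l ^ 3 / 2 + l ^ 4 / 2) ≤ E * (1 - 2 * l) * (l ^ 3 / 2 + l ^ 4 / 2) :=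
    mul_le_mul_of_nonneg_right (by linarith) (by positivity)
  have hmargin : 0 ≤ E * l ^ 4 * (5 / 18 + l) := by positivity
  linarith

end ElementaryBounds

section CoordinateEntropy

theorem integrable_continuous_comp {Ω E : Type*} [MeasurableSpace Ω] {P : Measure Ω}
    [IsFiniteMeasure P] [NormedAddCommGroup E] [ProperSpace E] [MeasurableSpace E] [BorelSpace E]
    {φ : E → ℝ} (hφ : Continuous φ) {W : Ω → E} (hW : Measurable W) {C : ℝ}
    (hb : ∀ ω, ‖W ω‖ ≤ C) : Integrable (fun ω => φ (W ω)) P := by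
  obtain ⟨B, hB⟩ := (isCompact_closedBall (0 : E) C).exists_bound_of_continuousOn hφ.continuousOn
  exact .of_bound (hφ.measurable.comp hW).aestronglyMeasurable B
    (ae_of_all _ fun ω => hB _ (mem_closedBall_zero_iff.2 (hb ω)))

theorem mul_exp_neg_le_of_le_integral_tiltedExp {Ω : Type*} [MeasurableSpace Ω] {P : Measure Ω}
    {W : Ω → ℝ} {l q ζ : ℝ} (hl : l < 1)
    (hqW : (1 - l) * q ≤ ∫ ω, tiltedExp l (W ω - ζ) ∂P) :
    q * Real.exp (-(l * ζ)) ≤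
      ∫ ω, Real.exp (-(l * W ω)) * (1 + l / (1 - l) * (W ω - ζ)) ∂P := by
  have hl' : 0 < 1 - l := by linarith
  calc q * Real.exp (-(l * ζ))
      = (1 - l) * q * ((1 - l)⁻¹ * Real.exp (-(l * ζ))) := by field_simp
    _ ≤ (∫ ω, tiltedExp l (W ω - ζ) ∂P) * ((1 - l)⁻¹ * Real.exp (-(l * ζ))) := by gcongr
    _ = ∫ ω, Real.exp (-(l * W ω)) * (1 + l / (1 - l) * (W ω - ζ)) ∂P := by
        rw [← integral_mul_const]
        congr with ω
        rw [tiltedExp, show -(l * W ω) = -(l * (W ω - ζ)) + -(l * ζ) by ring, Real.exp_add]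
        field_simp

theorem entropy_exp_neg_mul_le {Ω : Type*} [MeasurableSpace Ω] {P : Measure Ω}
    [IsProbabilityMeasure P] {W : Ω → ℝ} {l q ζ C : ℝ} (hW : Measurable W) (hb : ∀ ω, ‖W ω‖ ≤ C)
    (hl : l < 1) (hq : 0 < q) (hqW : (1 - l) * q ≤ ∫ ω, tiltedExp l (W ω - ζ) ∂P) :
    entropy P (fun ω => Real.exp (-(l * W ω))) ≤
      ∫ ω, Real.exp (-(l * W ω)) * (-Real.log q + l ^ 2 / (1 - l) * (W ω - ζ)) ∂P := by
  have hl' : 1 - l ≠ 0 := by linarith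
  have hi {φ : ℝ → ℝ} (hφ : Continuous φ) : Integrable (fun ω => φ (W ω)) P :=
    integrable_continuous_comp hφ hW hb
  have hiV := hi (φ := fun w => Real.exp (-(l * w))) (by fun_prop)
  have hiVlog := hi (φ := fun w => Real.exp (-(l * w)) * -(l * w)) (by fun_prop)
  have hiVaff := hi (φ := fun w => Real.exp (-(l * w)) * (1 + l / (1 - l) * (w - ζ))) (by fun_prop)
  set u := q * Real.exp (-(l * ζ))
  have hlogu : Real.log u = Real.log q + -(l * ζ) := by
    rw [Real.log_mul hq.ne' (Real.exp_ne_zero _), Real.log_exp]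
  calc entropy P (fun ω => Real.exp (-(l * W ω)))
      ≤ ∫ ω, Real.exp (-(l * W ω)) * -(l * W ω) ∂P -
          (∫ ω, Real.exp (-(l * W ω)) ∂P) * Real.log u - ∫ ω, Real.exp (-(l * W ω)) ∂P + u := by
        have h := entropy_le_integral_mul_log_sub (P := P) (Y := fun ω => Real.exp (-(l * W ω)))
          (integral_nonneg fun ω => (Real.exp_pos _).le) (by positivity : 0 < u)
        simpa only [Real.log_exp] using h
    _ ≤ ∫ ω, Real.exp (-(l * W ω)) * -(l * W ω) ∂P -
          (∫ ω, Real.exp (-(l * W ω)) ∂P) * (Real.log u + 1) +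
          ∫ ω, Real.exp (-(l * W ω)) * (1 + l / (1 - l) * (W ω - ζ)) ∂P := by
        linarith [mul_exp_neg_le_of_le_integral_tiltedExp hl hqW]
    _ = ∫ ω, Real.exp (-(l * W ω)) * (-Real.log q + l ^ 2 / (1 - l) * (W ω - ζ)) ∂P := by
        rw [← integral_mul_const, ← integral_sub hiVlog (hiV.mul_const _), ← integral_add
          (f := fun ω => Real.exp (-(l * W ω)) * -(l * W ω) -
            Real.exp (-(l * W ω)) * (Real.log u + 1)) (hiVlog.sub (hiV.mul_const _)) hiVaff]
        congr with ω
        rw [hlogu]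
        field_simp
        ring

variable {X : Type*} [MeasurableSpace X] {μ : Measure X} [IsProbabilityMeasure μ]

theorem integral_rademacher (g : ℤˣ → ℝ) : ∫ u, g u ∂rademacher = (g 1 + g (-1)) / 2 := by
  rw [rademacher, integral_smul_measure, integral_add_measure (by simp) (by simp)]
  simp
  ring

theorem abs_units_int_mul (u : ℤˣ) (x : ℝ) : |((u : ℤ) : ℝ) * x| = |x| := by
  rcases Int.units_eq_one_or u with rfl | rfl <;> simp

theorem measurable_sign_mul {f : X → ℝ} (hf : Measurable f) :
    Measurable fun p : X × ℤˣ => ((p.2 : ℤ) : ℝ) * f p.1 :=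
  ((Measurable.of_discrete (f := fun u : ℤˣ => ((u : ℤ) : ℝ))).comp measurable_snd).mul
    (hf.comp measurable_fst)

theorem le_integral_tiltedExp_mul_rademacher {f : X → ℝ} {l s : ℝ}
    (hl : l ∈ Set.Icc (0 : ℝ) (1 / 2)) (hf : Measurable f) (hf1 : ∀ x, |f x| ≤ 1)
    (hfs : ∫ x, f x ^ 2 ∂μ ≤ s) :
    (1 - l) * (1 - varianceLoss l * s) ≤
      ∫ p, tiltedExp l (((p.2 : ℤ) : ℝ) * f p.1) ∂μ.prod rademacher := by
  have hK := varianceLoss_nonneg hl.1 (by linarith [hl.2])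
  have hi {φ : ℝ → ℝ} (hφ : Continuous φ) : Integrable (fun x => φ (f x)) μ :=
    integrable_continuous_comp hφ hf hf1
  have hsq : Integrable (fun x => f x ^ 2) μ := hi (φ := fun y => y ^ 2) (by fun_prop)
  calc (1 - l) * (1 - varianceLoss l * s)
      ≤ (1 - l) * (1 - varianceLoss l * ∫ x, f x ^ 2 ∂μ) := by
        gcongr
        linarith [hl.2]
    _ = ∫ x, (1 - l) * (1 - varianceLoss l * f x ^ 2) ∂μ := by
        rw [integral_const_mul, integral_sub (integrable_const _) (hsq.const_mul _),
          integral_const_mul, integral_const, probReal_univ, one_smul]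
    _ ≤ ∫ x, (tiltedExp l (f x) + tiltedExp l (-f x)) / 2 ∂μ := by
        refine integral_mono (hi (φ := fun y => (1 - l) * (1 - varianceLoss l * y ^ 2))
          (by fun_prop)) (hi (φ := fun y => (tiltedExp l y + tiltedExp l (-y)) / 2) ?_)
          fun x => one_sub_mul_le_tiltedExp_add_neg hl (hf1 x)
        have := continuous_tiltedExp l
        fun_prop
    _ = ∫ p, tiltedExp l (((p.2 : ℤ) : ℝ) * f p.1) ∂μ.prod rademacher := by
        rw [integral_prod _ (integrable_continuous_comp (continuous_tiltedExp l)
          (measurable_sign_mul hf) (C := 1)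
          fun p => (abs_units_int_mul p.2 (f p.1)).trans_le (hf1 p.1))]
        simp [integral_rademacher]

theorem le_integral_tiltedExp_of_forall_exists {d : X × ℤˣ → ℝ} {l s : ℝ}
    (hl : l ∈ Set.Icc (0 : ℝ) (1 / 2)) (hd : Measurable d) (hd1 : ∀ p, |d p| ≤ 1)
    (happrox : ∀ ε > 0, ∃ f : X → ℝ, Measurable f ∧ (∀ x, |f x| ≤ 1) ∧ ∫ x, f x ^ 2 ∂μ ≤ s ∧
      ∀ p, ((p.2 : ℤ) : ℝ) * f p.1 - ε ≤ d p) :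
    (1 - l) * (1 - varianceLoss l * s) ≤ ∫ p, tiltedExp l (d p) ∂μ.prod rademacher := by
  have hi {w : X × ℤˣ → ℝ} (hw : Measurable w) (hw1 : ∀ p, |w p| ≤ 1) :
      Integrable (fun p => tiltedExp l (w p)) (μ.prod rademacher) :=
    integrable_continuous_comp (continuous_tiltedExp l) hw hw1
  suffices h : ∀ ε ∈ Set.Ioc (0 : ℝ) 1, (1 - l) * (1 - varianceLoss l * s) - 2 * ε ≤
      ∫ p, tiltedExp l (d p) ∂μ.prod rademacher by
    have hlim : Filter.Tendsto (fun ε : ℝ => (1 - l) * (1 - varianceLoss l * s) - 2 * ε)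
        (nhdsWithin 0 (Set.Ioi 0)) (nhds ((1 - l) * (1 - varianceLoss l * s) - 2 * 0)) :=
      ((by fun_prop : Continuous fun ε : ℝ =>
        (1 - l) * (1 - varianceLoss l * s) - 2 * ε).tendsto 0).mono_left nhdsWithin_le_nhds
    rw [mul_zero, sub_zero] at hlim
    exact le_of_tendsto hlim (Filter.eventually_of_mem (Ioc_mem_nhdsGT one_pos) h)
  intro ε hε
  obtain ⟨f, hf, hf1, hfs, hfd⟩ := happrox ε hε.1
  have hf1' (p : X × ℤˣ) : |((p.2 : ℤ) : ℝ) * f p.1| ≤ 1 :=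
    (abs_units_int_mul p.2 (f p.1)).trans_le (hf1 p.1)
  have hif := hi (measurable_sign_mul hf) hf1'
  calc (1 - l) * (1 - varianceLoss l * s) - 2 * ε
      ≤ ∫ p, tiltedExp l (((p.2 : ℤ) : ℝ) * f p.1) ∂μ.prod rademacher - 2 * ε := by
        gcongr
        exact le_integral_tiltedExp_mul_rademacher hl hf hf1 hfs
    _ = ∫ p, (tiltedExp l (((p.2 : ℤ) : ℝ) * f p.1) - 2 * ε) ∂μ.prod rademacher := by
        rw [integral_sub hif (integrable_const _), integral_const, probReal_univ, one_smul]
    _ ≤ ∫ p, tiltedExp l (d p) ∂μ.prod rademacher :=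
        integral_mono (hif.sub (integrable_const _)) (hi hd hd1) fun p =>
          tiltedExp_sub_two_mul_le hl (hf1' p) ⟨hε.1.le, hε.2⟩ (hfd p) (abs_le.1 (hd1 p)).2

end CoordinateEntropy

theorem exp_neg_mul_mem_Icc {l w C : ℝ} (hw : ‖w‖ ≤ C) :
    Real.exp (-(l * w)) ∈ Set.Icc (Real.exp (-(|l| * C))) (Real.exp (|l| * C)) := by
  have h : |l * w| ≤ |l| * C := by rw [abs_mul]; gcongr; exact hw
  exact ⟨Real.exp_le_exp.2 (neg_le_neg (abs_le.1 h).2),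
    Real.exp_le_exp.2 (neg_le.1 (abs_le.1 h).1)⟩

theorem entropy_exp_neg_mul_pi_le {n : ℕ} {Ω : Fin n → Type*} [∀ i, MeasurableSpace (Ω i)]
    {P : ∀ i, Measure (Ω i)} [∀ i, IsProbabilityMeasure (P i)] {Z : (∀ i, Ω i) → ℝ}
    {Z' : Fin n → (∀ i, Ω i) → ℝ} {l q C : ℝ} (hZ : Measurable Z) (hb : ∀ ω, ‖Z ω‖ ≤ C)
    (hZ' : ∀ i, Measurable (Z' i)) (hb' : ∀ i ω, ‖Z' i ω‖ ≤ C)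
    (hupdate : ∀ i ω x, Z' i (Function.update ω i x) = Z' i ω)
    (hsum : ∀ ω, ∑ i, (Z ω - Z' i ω) ≤ Z ω) (hl : l < 1) (hq : 0 < q)
    (hqZ : ∀ i ω, (1 - l) * q ≤ ∫ x, tiltedExp l (Z (Function.update ω i x) - Z' i ω) ∂P i) :
    entropy (Measure.pi P) (fun ω => Real.exp (-(l * Z ω))) ≤
      ∫ ω, Real.exp (-(l * Z ω)) * (n * -Real.log q + l ^ 2 / (1 - l) * Z ω) ∂Measure.pi P := by
  have : 0 < 1 - l := by linarith
  let D (i : Fin n) (ω : ∀ i, Ω i) : ℝ :=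
    Real.exp (-(l * Z ω)) * (-Real.log q + l ^ 2 / (1 - l) * (Z ω - Z' i ω))
  have hD (i : Fin n) : Integrable (D i) (Measure.pi P) :=
    integrable_continuous_comp (φ := fun w : ℝ × ℝ =>
        Real.exp (-(l * w.1)) * (-Real.log q + l ^ 2 / (1 - l) * (w.1 - w.2)))
      (by fun_prop) (hZ.prodMk (hZ' i)) fun ω => max_le (hb ω) (hb' i ω)
  calc entropy (Measure.pi P) (fun ω => Real.exp (-(l * Z ω)))
      ≤ ∑ i, ∫ ω, D i ω ∂Measure.pi P := by
        refine entropy_pi_le_sum_integral (Real.exp_pos (-(|l| * C))) (hZ.const_mul l).neg.exp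
          (fun ω => exp_neg_mul_mem_Icc (hb ω)) hD fun i ω => ?_
        simp only [D, hupdate]
        exact entropy_exp_neg_mul_le (hZ.comp (measurable_update ω)) (fun x => hb _) hl hq (hqZ i ω)
    _ = ∫ ω, ∑ i, D i ω ∂Measure.pi P := (integral_finsetSum _ fun i _ => hD i).symm
    _ ≤ _ := by
        refine integral_mono (integrable_finsetSum _ fun i _ => hD i) (integrable_continuous_comp
          (φ := fun w : ℝ => Real.exp (-(l * w)) * (n * -Real.log q + l ^ 2 / (1 - l) * w))
          (by fun_prop) hZ hb) fun ω => ?_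
        simp only [D, ← Finset.mul_sum, Finset.sum_add_distrib, Finset.sum_const, Finset.card_univ,
          Fintype.card_fin, nsmul_eq_mul]
        gcongr
        exact hsum ω

section Herbst

theorem antitoneOn_exp_mul_dslope_sub {G p : ℝ → ℝ} {c : ℝ} (hG : Differentiable ℝ G)
    (hp : Differentiable ℝ p) (hG0 : G 0 = 0)
    (hle : ∀ x ∈ Set.Ioo 0 c, x * deriv G x - (1 - x) * G x ≤ x ^ 2 * (p x + deriv p x)) :
    AntitoneOn (fun x => Real.exp x * (dslope G 0 x - p x)) (Set.Icc 0 c) := by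
  have hslope : Continuous (dslope G 0) := by
    refine continuous_iff_continuousAt.2 fun x => ?_
    rcases eq_or_ne x 0 with rfl | hx
    · exact continuousAt_dslope_same.2 (hG 0)
    · exact (continuousAt_dslope_of_ne hx).2 hG.continuous.continuousAt
  have hderiv {x : ℝ} (hx : 0 < x) : HasDerivAt (fun x => Real.exp x * (dslope G 0 x - p x))
      (Real.exp x / x ^ 2 * (x * deriv G x - (1 - x) * G x - x ^ 2 * (p x + deriv p x))) x := by
    have h := (Real.hasDerivAt_exp x).mul
      (((hG x).hasDerivAt.div (hasDerivAt_id x) hx.ne').sub (hp x).hasDerivAt)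
    refine (h.congr_of_eventuallyEq ?_).congr_deriv ?_
    · filter_upwards [eventually_ne_nhds hx.ne'] with y hy
      simp [dslope_of_ne _ hy, slope_def_field, hG0]
    · simp only [Pi.sub_apply, Pi.div_apply, id]
      field_simp
      ring
  refine antitoneOn_of_deriv_nonpos (convex_Icc 0 c)
    (Real.continuous_exp.mul (hslope.sub hp.continuous)).continuousOn ?_ ?_ <;> rw [interior_Icc]
  · exact fun x hx => (hderiv hx.1).differentiableAt.differentiableWithinAt
  · intro x hx
    rw [(hderiv hx.1).deriv]
    exact mul_nonpos_of_nonneg_of_nonpos (by positivity) (sub_nonpos.2 (hle x hx))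

theorem le_mul_of_deriv_le {G p : ℝ → ℝ} {c : ℝ} (hG : Differentiable ℝ G)
    (hp : Differentiable ℝ p) (hG0 : G 0 = 0) (hp0 : p 0 = 0)
    (hle : ∀ x ∈ Set.Ioo 0 c, x * deriv G x - (1 - x) * G x ≤ x ^ 2 * (p x + deriv p x)) {l : ℝ}
    (hl : l ∈ Set.Icc 0 c) : G l ≤ l * (Real.exp (-l) * deriv G 0 + p l) := by
  rcases hl.1.eq_or_lt with rfl | hl0
  · simp [hG0]
  have h : Real.exp l * (G l / l - p l) ≤ deriv G 0 := by
    simpa [dslope_of_ne _ hl0.ne', slope_def_field, hG0, hp0] using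
      antitoneOn_exp_mul_dslope_sub hG hp hG0 hle ⟨le_rfl, hl.1.trans hl.2⟩ hl hl.1
  have hquot : G l / l - p l ≤ Real.exp (-l) * deriv G 0 := by
    rwa [Real.exp_neg, ← div_eq_inv_mul, le_div_iff₀' (Real.exp_pos l)]
  calc G l = l * (G l / l - p l + p l) := by field_simp; ring
    _ ≤ l * (Real.exp (-l) * deriv G 0 + p l) := by gcongr

end Herbst

section CumulantGeneratingFunction

open ProbabilityTheory

variable {Ω : Type*} [MeasurableSpace Ω] {P : Measure Ω}

theorem integrableExpSet_eq_univ_of_bounded [IsFiniteMeasure P] {Z : Ω → ℝ} {C : ℝ}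
    (hZ : Measurable Z) (hb : ∀ ω, ‖Z ω‖ ≤ C) : integrableExpSet Z P = Set.univ :=
  Set.eq_univ_of_forall fun l =>
    integrable_continuous_comp (φ := fun z => Real.exp (l * z)) (by fun_prop) hZ hb

theorem entropy_exp_mul_eq_mgf_mul [NeZero P] {Y : Ω → ℝ} {l : ℝ}
    (hl : l ∈ interior (integrableExpSet Y P)) :
    entropy P (fun ω => Real.exp (l * Y ω)) =
      mgf Y P l * (l * deriv (cgf Y P) l - cgf Y P l) := by
  have hmgf : 0 < mgf Y P l :=
    mgf_pos' (NeZero.ne P) (interior_subset (s := integrableExpSet Y P) hl)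
  rw [deriv_cgf hl, entropy, cgf]
  simp only [Real.log_exp, mgf] at hmgf ⊢
  field_simp
  rw [← integral_const_mul]
  congr 1
  congr with ω
  ring

theorem mul_deriv_cgf_neg_sub_le [IsProbabilityMeasure P] {Z : Ω → ℝ} {C l β : ℝ}
    (hZ : Measurable Z) (hb : ∀ ω, ‖Z ω‖ ≤ C) (hl : l < 1)
    (hent : entropy P (fun ω => Real.exp (-(l * Z ω))) ≤
      ∫ ω, Real.exp (-(l * Z ω)) * (β + l ^ 2 / (1 - l) * Z ω) ∂P) :
    l * deriv (cgf (-Z) P) l - (1 - l) * cgf (-Z) P l ≤ (1 - l) * β := by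
  have hl' : 0 < 1 - l := by linarith
  have hset : l ∈ interior (integrableExpSet (-Z) P) := by
    rw [integrableExpSet_eq_univ_of_bounded hZ.neg fun ω => (norm_neg (Z ω)).trans_le (hb ω)]
    simp
  have hmgf : 0 < mgf (-Z) P l :=
    mgf_pos (interior_subset (s := integrableExpSet (-Z) P) hset)
  have hderiv : mgf (-Z) P l * deriv (cgf (-Z) P) l = -∫ ω, Real.exp (-(l * Z ω)) * Z ω ∂P := by
    rw [deriv_cgf hset, mul_div_cancel₀ _ hmgf.ne', ← integral_neg]
    congr with ω
    simp [mul_comm]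
  have hi {φ : ℝ → ℝ} (hφ : Continuous φ) : Integrable (fun ω => φ (Z ω)) P :=
    integrable_continuous_comp hφ hZ hb
  have hright : ∫ ω, Real.exp (-(l * Z ω)) * (β + l ^ 2 / (1 - l) * Z ω) ∂P =
      mgf (-Z) P l * (β - l ^ 2 / (1 - l) * deriv (cgf (-Z) P) l) := by
    rw [mul_sub, mul_left_comm, hderiv, mul_neg, sub_neg_eq_add, mgf, ← integral_const_mul,
      ← integral_mul_const]
    simp only [Pi.neg_apply, mul_neg]
    rw [← integral_add ((hi (φ := fun z => Real.exp (-(l * z))) (by fun_prop)).mul_const _)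
      ((hi (φ := fun z => Real.exp (-(l * z)) * z) (by fun_prop)).const_mul _)]
    congr with ω
    ring
  have hleft := entropy_exp_mul_eq_mgf_mul hset
  simp only [Pi.neg_apply, mul_neg] at hleft
  rw [hleft, hright] at hent
  have h := mul_le_mul_of_nonneg_left (le_of_mul_le_mul_left hent hmgf) hl'.le
  field_simp at h
  linarith

theorem measureReal_lt_sub_sqrt_le [IsProbabilityMeasure P] {Z : Ω → ℝ} {C E v t : ℝ}
    (hZ : Measurable Z) (hb : ∀ ω, ‖Z ω‖ ≤ C) (hZ0 : ∀ ω, 0 ≤ Z ω) (hEv : E ≤ v) (ht : 0 ≤ t)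
    (hcgf : ∀ l ∈ Set.Icc 0 (E / v), cgf (-Z) P l + l * E ≤ l ^ 2 * v / 2) :
    P.real {ω | Z ω < E - √(2 * v * t)} ≤ Real.exp (-t) := by
  set r := √(2 * v * t)
  rcases le_or_gt E r with hEr | hrE
  · have hempty : {ω | Z ω < E - r} = ∅ :=
      Set.eq_empty_of_forall_notMem fun ω (hω : Z ω < E - r) => by linarith [hZ0 ω]
    rw [hempty, measureReal_empty]
    positivity
  have hr0 : 0 ≤ r := Real.sqrt_nonneg _
  have hv : 0 < v := by linarith
  have hr2 : r ^ 2 = 2 * v * t := Real.sq_sqrt (by positivity)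
  have hl : r / v ∈ Set.Icc 0 (E / v) := ⟨by positivity, by gcongr⟩
  have hint : Integrable (fun ω => Real.exp (r / v * (-Z) ω)) P :=
    integrable_continuous_comp (φ := fun z => Real.exp (r / v * -z)) (by fun_prop) hZ hb
  calc P.real {ω | Z ω < E - r} ≤ P.real {ω | -(E - r) ≤ (-Z) ω} :=
        measureReal_mono fun ω (hω : Z ω < E - r) => neg_le_neg hω.le
    _ ≤ Real.exp (-(r / v) * -(E - r) + cgf (-Z) P (r / v)) := measure_ge_le_exp_cgf _ hl.1 hint
    _ ≤ Real.exp (-t) := by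
        refine Real.exp_le_exp.2 ?_
        have hrv : r / v * r = 2 * t := by field_simp; linarith
        have hrv' : (r / v) ^ 2 * v / 2 = t := by field_simp; linarith
        linarith [hcgf _ hl]

end CumulantGeneratingFunction

section RademacherSup

open ProbabilityTheory

variable {ι X : Type*}

/-- The unnormalized supremum `sup_j ∑ᵢ σᵢ gⱼ(sᵢ)`, a function of the signed sample
`((s₁, σ₁), …, (sₙ, σₙ))`. A supremum over an empty or unbounded family is `0`. -/
noncomputable def rademacherSup {n : ℕ} (g : ι → X → ℝ) (ω : Fin n → X × ℤˣ) : ℝ :=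
  ⨆ j, ∑ i, (((ω i).2 : ℤ) : ℝ) * g j (ω i).1

variable {g : ι → X → ℝ} {n : ℕ}

theorem abs_sum_sign_mul_le (hg : ∀ j x, |g j x| ≤ 1) (ω : Fin n → X × ℤˣ) (j : ι) :
    |∑ i, (((ω i).2 : ℤ) : ℝ) * g j (ω i).1| ≤ n := by
  refine (Finset.abs_sum_le_sum_abs _ _).trans ?_
  simp only [abs_units_int_mul]
  simpa using Finset.sum_le_card_nsmul Finset.univ (fun i => |g j (ω i).1|) 1 fun i _ => hg j _

theorem sum_le_rademacherSup (hg : ∀ j x, |g j x| ≤ 1) (ω : Fin n → X × ℤˣ) (j : ι) :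
    ∑ i, (((ω i).2 : ℤ) : ℝ) * g j (ω i).1 ≤ rademacherSup g ω :=
  le_ciSup (f := fun j => ∑ i, (((ω i).2 : ℤ) : ℝ) * g j (ω i).1)
    ⟨n, Set.forall_mem_range.2 fun j => (abs_le.1 (abs_sum_sign_mul_le hg ω j)).2⟩ j

theorem rademacherSup_nonneg_of_zero (hg : ∀ j x, |g j x| ≤ 1) (hzero : ∃ j, g j = 0)
    (ω : Fin n → X × ℤˣ) : 0 ≤ rademacherSup g ω := by
  obtain ⟨j, hj⟩ := hzero
  simpa [hj] using sum_le_rademacherSup hg ω j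

variable [Nonempty ι]

theorem abs_rademacherSup_le (hg : ∀ j x, |g j x| ≤ 1) (ω : Fin n → X × ℤˣ) :
    |rademacherSup g ω| ≤ n := by
  obtain ⟨j⟩ := ‹Nonempty ι›
  exact abs_le.2 ⟨(abs_le.1 (abs_sum_sign_mul_le hg ω j)).1.trans (sum_le_rademacherSup hg ω j),
    ciSup_le fun j => (abs_le.1 (abs_sum_sign_mul_le hg ω j)).2⟩

theorem abs_rademacherSup_sub_removeNth_le (hg : ∀ j x, |g j x| ≤ 1) (i : Fin (n + 1))
    (ω : Fin (n + 1) → X × ℤˣ) : |rademacherSup g ω - rademacherSup g (i.removeNth ω)| ≤ 1 := by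
  have hterm (j : ι) := abs_le.1 ((abs_units_int_mul (ω i).2 (g j (ω i).1)).trans_le (hg j _))
  have hsplit (j : ι) := Fin.sum_univ_succAbove (fun k => (((ω k).2 : ℤ) : ℝ) * g j (ω k).1) i
  have hupper : rademacherSup g ω ≤ rademacherSup g (i.removeNth ω) + 1 := ciSup_le fun j => by
    have h := sum_le_rademacherSup hg (i.removeNth ω) j
    simp only [Fin.removeNth] at h ⊢
    linarith [hsplit j, (hterm j).2]
  have hlower : rademacherSup g (i.removeNth ω) ≤ rademacherSup g ω + 1 := ciSup_le fun j => by
    have h := sum_le_rademacherSup hg ω j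
    simp only [Fin.removeNth]
    linarith [hsplit j, (hterm j).1]
  exact abs_sub_le_iff.2 ⟨by linarith, by linarith⟩

theorem sum_rademacherSup_sub_removeNth_le (hg : ∀ j x, |g j x| ≤ 1)
    (ω : Fin (n + 1) → X × ℤˣ) :
    ∑ i : Fin (n + 1), (rademacherSup g ω - rademacherSup g (i.removeNth ω)) ≤
      rademacherSup g ω := by
  suffices (n : ℝ) * rademacherSup g ω ≤
      ∑ i : Fin (n + 1), rademacherSup g (i.removeNth ω) by
    simp only [Finset.sum_sub_distrib, Finset.sum_const, Finset.card_univ, Fintype.card_fin,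
      nsmul_eq_mul, Nat.cast_add, Nat.cast_one]
    linarith
  rw [rademacherSup, Real.mul_iSup_of_nonneg n.cast_nonneg]
  refine ciSup_le fun j => ?_
  set t : Fin (n + 1) → ℝ := fun k => (((ω k).2 : ℤ) : ℝ) * g j (ω k).1
  calc (n : ℝ) * ∑ k, t k = ∑ i, (∑ k, t k - t i) := by
        simp [Finset.sum_sub_distrib]; ring
    _ = ∑ i, ∑ k, t (i.succAbove k) :=
        Finset.sum_congr rfl fun i _ => by rw [Fin.sum_univ_succAbove t i, add_sub_cancel_left]
    _ ≤ ∑ i : Fin (n + 1), rademacherSup g (i.removeNth ω) :=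
        Finset.sum_le_sum fun i _ => sum_le_rademacherSup hg (i.removeNth ω) j

theorem exists_forall_sub_le_rademacherSup_update_sub (hg : ∀ j x, |g j x| ≤ 1)
    (i : Fin (n + 1)) (ω : Fin (n + 1) → X × ℤˣ) {ε : ℝ} (hε : 0 < ε) :
    ∃ j, ∀ p : X × ℤˣ, ((p.2 : ℤ) : ℝ) * g j p.1 - ε ≤
      rademacherSup g (Function.update ω i p) - rademacherSup g (i.removeNth ω) := by
  obtain ⟨j, hj⟩ := exists_lt_of_lt_ciSup (sub_lt_self (rademacherSup g (i.removeNth ω)) hε)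
  refine ⟨j, fun p => ?_⟩
  have h := sum_le_rademacherSup hg (Function.update ω i p) j
  rw [Fin.sum_univ_succAbove _ i] at h
  simp only [Function.update_self, Function.update_of_ne (Fin.succAbove_ne i _)] at h
  simp only [Fin.removeNth] at hj ⊢
  linarith

variable [MeasurableSpace X] {μ : Measure X} [IsProbabilityMeasure μ] {s l : ℝ}

theorem le_integral_tiltedExp_rademacherSup (hg : ∀ j x, |g j x| ≤ 1)
    (hgm : ∀ j, Measurable (g j)) (hgs : ∀ j, ∫ x, g j x ^ 2 ∂μ ≤ s)
    (hm : Measurable fun ω : Fin (n + 1) → X × ℤˣ => rademacherSup g ω)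
    (hl : l ∈ Set.Icc (0 : ℝ) (1 / 2)) (i : Fin (n + 1)) (ω : Fin (n + 1) → X × ℤˣ) :
    (1 - l) * (1 - varianceLoss l * s) ≤
      ∫ p, tiltedExp l (rademacherSup g (Function.update ω i p) -
        rademacherSup g (i.removeNth ω)) ∂μ.prod rademacher := by
  refine le_integral_tiltedExp_of_forall_exists hl
    ((hm.comp (measurable_update ω)).sub_const _) (fun p => ?_) fun ε hε => ?_
  · simpa only [Fin.removeNth_update] using
      abs_rademacherSup_sub_removeNth_le hg i (Function.update ω i p)
  · obtain ⟨j, hj⟩ := exists_forall_sub_le_rademacherSup_update_sub hg i ω hε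
    exact ⟨g j, hgm j, hg j, hgs j, hj⟩

theorem entropy_exp_neg_mul_rademacherSup_le (hg : ∀ j x, |g j x| ≤ 1)
    (hgm : ∀ j, Measurable (g j)) (hs : s ≤ 1) (hgs : ∀ j, ∫ x, g j x ^ 2 ∂μ ≤ s)
    (hm : ∀ k, Measurable fun ω : Fin k → X × ℤˣ => rademacherSup g ω)
    (hl : l ∈ Set.Icc (0 : ℝ) (1 / 2)) :
    entropy (Measure.pi fun _ : Fin (n + 1) => μ.prod rademacher)
        (fun ω => Real.exp (-(l * rademacherSup g ω))) ≤
      ∫ ω, Real.exp (-(l * rademacherSup g ω)) *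
          (((n + 1 : ℕ) : ℝ) * -Real.log (1 - varianceLoss l * s) +
            l ^ 2 / (1 - l) * rademacherSup g ω)
        ∂Measure.pi fun _ : Fin (n + 1) => μ.prod rademacher := by
  have hK0 := varianceLoss_nonneg hl.1 (by linarith [hl.2])
  have hK1 := varianceLoss_lt_one hl.1 hl.2
  refine entropy_exp_neg_mul_pi_le (C := (n + 1 : ℕ))
    (Z' := fun i ω => rademacherSup g (i.removeNth ω)) (hm _) (abs_rademacherSup_le hg)
    (fun i => (hm n).comp (measurable_pi_lambda _ fun k => measurable_pi_apply _))
    (fun i ω => (abs_rademacherSup_le hg _).trans (by simp))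
    (fun i ω x => by rw [Fin.removeNth_update]) (sum_rademacherSup_sub_removeNth_le hg)
    (by linarith [hl.2]) (by nlinarith)
    (le_integral_tiltedExp_rademacherSup hg hgm hgs (hm _) hl)

theorem mul_deriv_cgf_neg_rademacherSup_sub_le (hg : ∀ j x, |g j x| ≤ 1)
    (hgm : ∀ j, Measurable (g j)) (hs0 : 0 ≤ s) (hs1 : s ≤ 1) (hgs : ∀ j, ∫ x, g j x ^ 2 ∂μ ≤ s)
    (hm : ∀ k, Measurable fun ω : Fin k → X × ℤˣ => rademacherSup g ω)
    (hl : l ∈ Set.Icc (0 : ℝ) (1 / 2)) :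
    l * deriv (cgf (-rademacherSup g) (Measure.pi fun _ : Fin (n + 1) => μ.prod rademacher)) l -
        (1 - l) * cgf (-rademacherSup g) (Measure.pi fun _ : Fin (n + 1) => μ.prod rademacher) l ≤
      ((n + 1 : ℕ) : ℝ) * s *
        (l ^ 2 * (1 / 2 + l / 2 + 3 / 2 * l ^ 2 + 5 / 2 * l ^ 3 + l ^ 4 / 2)) := by
  have hl1 : 0 < 1 - l := by linarith [hl.2]
  calc _ ≤ (1 - l) * (((n + 1 : ℕ) : ℝ) * -Real.log (1 - varianceLoss l * s)) :=
        mul_deriv_cgf_neg_sub_le (hm _) (abs_rademacherSup_le hg) (by linarith)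
          (entropy_exp_neg_mul_rademacherSup_le hg hgm hs1 hgs hm hl)
    _ ≤ (1 - l) * (((n + 1 : ℕ) : ℝ) * (s * (varianceLoss l / (1 - varianceLoss l)))) := by
        gcongr
        exact neg_log_one_sub_mul_le (varianceLoss_nonneg hl.1 (by linarith))
          (varianceLoss_lt_one hl.1 hl.2) hs0 hs1
    _ = ((n + 1 : ℕ) : ℝ) * s * ((1 - l) * (varianceLoss l / (1 - varianceLoss l))) := by ring
    _ ≤ _ := mul_le_mul_of_nonneg_left (one_sub_mul_varianceLoss_div_le hl) (by positivity)

theorem cgf_neg_rademacherSup_le (hg : ∀ j x, |g j x| ≤ 1) (hgm : ∀ j, Measurable (g j))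
    (hs0 : 0 ≤ s) (hs1 : s ≤ 1) (hgs : ∀ j, ∫ x, g j x ^ 2 ∂μ ≤ s)
    (hm : ∀ k, Measurable fun ω : Fin k → X × ℤˣ => rademacherSup g ω)
    (hl : l ∈ Set.Icc (0 : ℝ) (1 / 2)) :
    cgf (-rademacherSup g) (Measure.pi fun _ : Fin (n + 1) => μ.prod rademacher) l ≤
      l * (Real.exp (-l) *
        -∫ ω, rademacherSup g ω ∂(Measure.pi fun _ : Fin (n + 1) => μ.prod rademacher) +
        ((n + 1 : ℕ) : ℝ) * s * (l / 2 + l ^ 3 / 2 + l ^ 4 / 2)) := by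
  set P := Measure.pi fun _ : Fin (n + 1) => μ.prod rademacher
  set c : ℝ := ((n + 1 : ℕ) : ℝ) * s
  have hset : interior (integrableExpSet (-rademacherSup g) P) = Set.univ := by
    rw [integrableExpSet_eq_univ_of_bounded (hm _).neg fun ω =>
      (norm_neg _).trans_le (abs_rademacherSup_le hg ω), interior_univ]
  have hdiff : Differentiable ℝ (cgf (-rademacherSup g) P) := fun x =>
    (analyticAt_cgf (hset ▸ Set.mem_univ x)).differentiableAt
  have hderiv0 : deriv (cgf (-rademacherSup g) P) 0 = -∫ ω, rademacherSup g ω ∂P := by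
    rw [deriv_cgf_zero (hset ▸ Set.mem_univ 0), probReal_univ, div_one, ← integral_neg]
    rfl
  have hp (x : ℝ) : HasDerivAt (fun x : ℝ => c * (x / 2 + x ^ 3 / 2 + x ^ 4 / 2))
      (c * (1 / 2 + 3 * x ^ 2 / 2 + 4 * x ^ 3 / 2)) x := by
    simpa using ((((hasDerivAt_id x).div_const 2).add ((hasDerivAt_pow 3 x).div_const 2)).add
      ((hasDerivAt_pow 4 x).div_const 2)).const_mul c
  have h := le_mul_of_deriv_le hdiff (fun x => (hp x).differentiableAt) cgf_zero (by simp)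
    (fun x hx => ?_) hl
  · rwa [hderiv0] at h
  · rw [(hp x).deriv]
    refine (mul_deriv_cgf_neg_rademacherSup_sub_le hg hgm hs0 hs1 hgs hm
      (Set.Ioo_subset_Icc_self hx)).trans_eq ?_
    ring

theorem measureReal_rademacherSup_lt_le (hg : ∀ j x, |g j x| ≤ 1) (hzero : ∃ j, g j = 0)
    (hgm : ∀ j, Measurable (g j)) (hs0 : 0 ≤ s) (hs1 : s ≤ 1) (hgs : ∀ j, ∫ x, g j x ^ 2 ∂μ ≤ s)
    (hm : ∀ k, Measurable fun ω : Fin k → X × ℤˣ => rademacherSup g ω) {E t : ℝ} (ht : 0 ≤ t)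
    (hE : E = ∫ ω, rademacherSup g ω ∂(Measure.pi fun _ : Fin (n + 1) => μ.prod rademacher)) :
    (Measure.pi fun _ : Fin (n + 1) => μ.prod rademacher).real
        {ω | rademacherSup g ω < E - √(2 * (2 * E + ((n + 1 : ℕ) : ℝ) * s) * t)} ≤
      Real.exp (-t) := by
  have hE0 : 0 ≤ E := hE ▸ integral_nonneg (rademacherSup_nonneg_of_zero hg hzero)
  have hNs : 0 ≤ ((n + 1 : ℕ) : ℝ) * s := by positivity
  set v := 2 * E + ((n + 1 : ℕ) : ℝ) * s
  refine measureReal_lt_sub_sqrt_le (hm _) (abs_rademacherSup_le hg)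
    (rademacherSup_nonneg_of_zero hg hzero) (by linarith) ht fun l hl => ?_
  have hlv : l * v ≤ E := by
    rcases eq_or_ne v 0 with hv | hv
    · simpa [hv]
    · exact (le_div_iff₀ (by positivity)).1 hl.2
  have hl' : l ∈ Set.Icc (0 : ℝ) (1 / 2) :=
    ⟨hl.1, hl.2.trans (div_le_of_le_mul₀ (by positivity) (by norm_num) (by linarith))⟩
  have hcgf := cgf_neg_rademacherSup_le (n := n) hg hgm hs0 hs1 hgs hm hl'
  rw [← hE] at hcgf
  exact (add_le_add_left hcgf _).trans (herbst_bound_le hE0 hl' hlv)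

end RademacherSup

theorem add_sqrt_le_of_le_add_sqrt {m z t w R r : ℝ} (hm : 0 < m) (hz : 0 ≤ z) (ht : 0 ≤ t)
    (hw : 0 ≤ w) (hR : 0 ≤ R) (h : R ≤ r + √(2 * (2 * z * R + w) * t / m)) :
    r + √(2 * (2 * z * R + w) * t / m) + z * t / (8 * m) ≤
      r + √(9 / 8 * (2 * z * t / m) ^ 2 + 2 * (2 * z * r + w) * t / m) + 17 * z * t / (8 * m) := by
  have hT : √(2 * (2 * z * R + w) * t / m) ^ 2 = 2 * (2 * z * R + w) * t / m :=
    Real.sq_sqrt (by positivity)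
  set T := √(2 * (2 * z * R + w) * t / m)
  suffices T - 2 * (z * t / m) ≤ √(9 / 8 * (2 * z * t / m) ^ 2 + 2 * (2 * z * r + w) * t / m) by
    have hsum : z * t / (8 * m) + 2 * (z * t / m) = 17 * z * t / (8 * m) := by field_simp; ring
    linarith
  refine Real.le_sqrt_of_sq_le ?_
  calc (T - 2 * (z * t / m)) ^ 2
      = 4 * (z * t / m) * (R - T) + 2 * w * t / m + 4 * (z * t / m) ^ 2 := by
        rw [sub_sq, hT]; ring
    _ ≤ 4 * (z * t / m) * r + 2 * w * t / m + 9 / 2 * (z * t / m) ^ 2 := by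
        gcongr
        · linarith
        · norm_num
    _ = 9 / 8 * (2 * z * t / m) ^ 2 + 2 * (2 * z * r + w) * t / m := by ring

section MonteCarlo

variable {X : Type*} {F : Set (X → ℝ)} {z : ℝ} {k : ℕ}

/-- The functions of the class `F` divided by `z`, as a family indexed by `F`. -/
noncomputable def rescale (F : Set (X → ℝ)) (z : ℝ) : F → X → ℝ := fun f x => (f : X → ℝ) x / z

theorem abs_rescale_le_one (hz : 0 < z) (hF : ∀ f ∈ F, ∀ x, |f x| ≤ z) (f : F) (x : X) :
    |rescale F z f x| ≤ 1 := by
  rw [rescale, abs_div, abs_of_pos hz]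
  exact div_le_one_of_le₀ (hF f f.2 x) hz.le

theorem mcera_eq_rademacherSup (hz : 0 < z) (S : Fin k → X) (σ : Fin 1 → Fin k → ℤˣ) :
    mcera F S σ = z / k * rademacherSup (rescale F z) fun i => (S i, σ 0 i) := by
  simp only [mcera, rademacherSup, rescale, Finset.univ_unique, Finset.sum_singleton,
    Fin.default_eq_zero, Nat.cast_one, div_one, one_mul]
  rw [Real.mul_iSup_of_nonneg (by positivity)]
  refine iSup_congr fun f => ?_
  rw [Finset.mul_sum, Finset.mul_sum]
  exact Finset.sum_congr rfl fun i _ => by field_simp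

theorem exists_rescale_eq_zero (h0 : (fun _ => 0) ∈ F) (z : ℝ) : ∃ f, rescale F z f = 0 :=
  ⟨⟨_, h0⟩, funext fun _ => zero_div z⟩

theorem mcera_nonneg (hz : 0 < z) (hF : ∀ f ∈ F, ∀ x, |f x| ≤ z) (h0 : (fun _ => 0) ∈ F)
    (S : Fin k → X) (σ : Fin 1 → Fin k → ℤˣ) : 0 ≤ mcera F S σ := by
  rw [mcera_eq_rademacherSup hz]
  exact mul_nonneg (by positivity)
    (rademacherSup_nonneg_of_zero (abs_rescale_le_one hz hF) (exists_rescale_eq_zero h0 z) _)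

variable [MeasurableSpace X]

theorem measurable_rademacherSup_rescale (hz : 0 < z)
    (hmeas : ∀ σ : Fin 1 → Fin k → ℤˣ, Measurable fun S : Fin k → X => mcera F S σ) :
    Measurable fun ω : Fin k → X × ℤˣ => rademacherSup (rescale F z) ω := by
  rcases k.eq_zero_or_pos with rfl | hk
  · exact Subsingleton.measurable
  have heq : (fun ω : Fin k → X × ℤˣ => rademacherSup (rescale F z) ω) =
      fun ω => k / z * mcera F (fun i => (ω i).1) fun (_ : Fin 1) i => (ω i).2 := by
    ext ω
    rw [mcera_eq_rademacherSup hz]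
    field_simp
  have hjoint : Measurable fun p : (Fin k → X) × (Fin 1 → Fin k → ℤˣ) => mcera F p.1 p.2 :=
    measurable_from_prod_countable_left hmeas
  rw [heq]
  exact (hjoint.comp (f := fun ω : Fin k → X × ℤˣ => (fun i => (ω i).1, fun _ i => (ω i).2))
    (by fun_prop)).const_mul _

variable {μ : Measure X} [IsProbabilityMeasure μ]

theorem integral_sq_le_of_abs_le {f : X → ℝ} (hf : ∀ x, |f x| ≤ z) : ∫ x, f x ^ 2 ∂μ ≤ z ^ 2 := by
  simpa using integral_mono_of_nonneg (ae_of_all μ fun x => sq_nonneg (f x))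
    (integrable_const (z ^ 2))
    (ae_of_all μ fun x => sq_le_sq.2 ((hf x).trans (le_abs_self z)))

theorem integral_sq_le_wimpyVariance (hF : ∀ f ∈ F, ∀ x, |f x| ≤ z) (f : F) :
    ∫ x, (f : X → ℝ) x ^ 2 ∂μ ≤ wimpyVariance μ F :=
  le_ciSup (f := fun f : F => ∫ x, (f : X → ℝ) x ^ 2 ∂μ)
    ⟨z ^ 2, Set.forall_mem_range.2 fun f => integral_sq_le_of_abs_le (hF f f.2)⟩ f

theorem wimpyVariance_nonneg (μ : Measure X) (F : Set (X → ℝ)) : 0 ≤ wimpyVariance μ F :=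
  Real.iSup_nonneg fun _ => integral_nonneg fun _ => sq_nonneg _

theorem wimpyVariance_le_sq [Nonempty F] (hF : ∀ f ∈ F, ∀ x, |f x| ≤ z) :
    wimpyVariance μ F ≤ z ^ 2 :=
  ciSup_le fun f => integral_sq_le_of_abs_le (hF f f.2)

theorem integral_rescale_sq_le (hF : ∀ f ∈ F, ∀ x, |f x| ≤ z) (f : F) :
    ∫ x, rescale F z f x ^ 2 ∂μ ≤ wimpyVariance μ F / z ^ 2 := by
  simp only [rescale, div_pow, integral_div]
  gcongr
  exact integral_sq_le_wimpyVariance hF f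

instance : IsProbabilityMeasure (sampleLaw μ k) := by
  unfold sampleLaw; infer_instance

instance (n : ℕ) : IsProbabilityMeasure (signLaw n k) := by
  unfold signLaw; infer_instance

theorem measurePreserving_sample_sign (μ : Measure X) [IsProbabilityMeasure μ] (k : ℕ) :
    MeasurePreserving (fun p : (Fin k → X) × (Fin 1 → Fin k → ℤˣ) => fun i => (p.1 i, p.2 0 i))
      ((sampleLaw μ k).prod (signLaw 1 k)) (Measure.pi fun _ => μ.prod rademacher) :=
  (measurePreserving_arrowProdEquivProdArrow X ℤˣ (Fin k) (fun _ => μ)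
    fun _ => rademacher).symm.comp ((MeasurePreserving.id _).prod
      (measurePreserving_funUnique (Measure.pi fun _ : Fin k => rademacher) (Fin 1)))

theorem rademacherComplexity_eq [Nonempty F] (hz : 0 < z) (hF : ∀ f ∈ F, ∀ x, |f x| ≤ z)
    (hmeas : ∀ σ : Fin 1 → Fin k → ℤˣ, Measurable fun S : Fin k → X => mcera F S σ) :
    rademacherComplexity μ F k =
      z / k *
        ∫ ω, rademacherSup (rescale F z) ω ∂(Measure.pi fun _ : Fin k => μ.prod rademacher) := by
  have hmp := measurePreserving_sample_sign μ k
  have hsup := measurable_rademacherSup_rescale hz hmeas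
  have hint : Integrable (rademacherSup (rescale F z))
      (Measure.pi fun _ : Fin k => μ.prod rademacher) :=
    .of_bound hsup.aestronglyMeasurable k
      (ae_of_all _ fun ω => abs_rademacherSup_le (abs_rescale_le_one hz hF) ω)
  simp only [rademacherComplexity, era, mcera_eq_rademacherSup hz, integral_const_mul]
  rw [← hmp.map_eq, integral_map hmp.aemeasurable hsup.aestronglyMeasurable]
  exact congrArg _ (integral_prod _ (hmp.integrable_comp_of_integrable hint)).symm

theorem sqrt_two_mul_add_rescale {E w t : ℝ} (hz : 0 < z) (hk : 0 < k) :
    √(2 * (2 * z * (z / k * E) + w) * t / k) =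
      z / k * √(2 * (2 * E + k * (w / z ^ 2)) * t) := by
  rw [← Real.sqrt_sq (by positivity : 0 ≤ z / (k : ℝ)), ← Real.sqrt_mul (by positivity),
    Real.sqrt_sq (by positivity)]
  congr 1
  field_simp

theorem one_sub_exp_neg_le_measureReal_rademacherComplexity_le (hz : 0 < z)
    (hF : ∀ f ∈ F, ∀ x, |f x| ≤ z) (h0 : (fun _ => 0) ∈ F) (hFmeas : ∀ f ∈ F, Measurable f)
    (hmeas : ∀ (k : ℕ) (σ : Fin 1 → Fin k → ℤˣ), Measurable fun S : Fin k → X => mcera F S σ)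
    (hk : 0 < k) {t : ℝ} (ht : 0 ≤ t) :
    1 - Real.exp (-t) ≤ ((sampleLaw μ k).prod (signLaw 1 k)).real
      {p | rademacherComplexity μ F k ≤ mcera F p.1 p.2 +
        √(2 * (2 * z * rademacherComplexity μ F k + wimpyVariance μ F) * t / k)} := by
  have : Nonempty F := ⟨⟨_, h0⟩⟩
  have hsup (j : ℕ) : Measurable fun ω : Fin j → X × ℤˣ => rademacherSup (rescale F z) ω :=
    measurable_rademacherSup_rescale hz (hmeas j)
  obtain ⟨n, rfl⟩ := Nat.exists_eq_succ_of_ne_zero hk.ne'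
  have htail := measureReal_rademacherSup_lt_le (μ := μ) (n := n) (abs_rescale_le_one hz hF)
    (exists_rescale_eq_zero h0 z) (fun f => (hFmeas f f.2).div_const z)
    (div_nonneg (wimpyVariance_nonneg μ F) (sq_nonneg z))
    (div_le_one_of_le₀ (wimpyVariance_le_sq hF) (sq_nonneg z)) (integral_rescale_sq_le hF) hsup ht
    rfl
  set A := {ω | rademacherSup (rescale F z) ω < _}
  have hA : MeasurableSet A := measurableSet_lt (hsup _) measurable_const
  calc 1 - Real.exp (-t) ≤ (Measure.pi fun _ : Fin (n + 1) => μ.prod rademacher).real Aᶜ := by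
        rw [probReal_compl_eq_one_sub hA]
        linarith
    _ = _ := by
        rw [← (measurePreserving_sample_sign μ (n + 1)).measureReal_preimage
          hA.compl.nullMeasurableSet]
        congr 1 with p
        simp only [A, Set.mem_preimage, Set.mem_compl_iff, Set.mem_ofPred_eq, not_lt]
        rw [rademacherComplexity_eq hz hF (hmeas _), mcera_eq_rademacherSup hz,
          sqrt_two_mul_add_rescale hz hk, ← mul_add,
          mul_le_mul_iff_of_pos_left (by positivity), sub_le_iff_le_add]

end MonteCarlo

theorem mainTheorem4 {X : Type*} [MeasurableSpace X] (μ : Measure X) [IsProbabilityMeasure μ]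
    (F : Set (X → ℝ)) (a b z : ℝ) (hb : 0 < b) (ha : a ≤ 0) (hz : z = max |a| |b|)
    (hF : ∀ f ∈ F, ∀ x, f x ∈ Set.Icc a b) (h0 : (fun _ => 0) ∈ F)
    (hFmeas : ∀ f ∈ F, Measurable f)
    (hmeas : ∀ (k : ℕ) (σ : Fin 1 → Fin k → ℤˣ), Measurable fun S : Fin k → X => mcera F S σ)
    (m : ℕ) (hm : 0 < m) (δ : ℝ) (hδ0 : 0 < δ) (hδ1 : δ < 1) :
    1 - δ ≤ ((sampleLaw μ m).prod (signLaw 1 m)).real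
      {p : (Fin m → X) × (Fin 1 → Fin m → ℤˣ) |
        rademacherComplexity μ F m ≤
          mcera F p.1 p.2
            + √(2 * (2 * z * rademacherComplexity μ F m + wimpyVariance μ F)
                * Real.log (1 / δ) / m)
            + z * Real.log (1 / δ) / (8 * m) ∧
        mcera F p.1 p.2
            + √(2 * (2 * z * rademacherComplexity μ F m + wimpyVariance μ F)
                * Real.log (1 / δ) / m)
            + z * Real.log (1 / δ) / (8 * m) ≤
          mcera F p.1 p.2
            + √(9 / 8 * (2 * z * Real.log (1 / δ) / m) ^ 2
                + 2 * (2 * z * mcera F p.1 p.2 + wimpyVariance μ F) * Real.log (1 / δ) / m)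
            + 17 * z * Real.log (1 / δ) / (8 * m)} := by
  have hz0 : 0 < z := hz ▸ (abs_pos.2 hb.ne').trans_le (le_max_right _ _)
  have hFz : ∀ f ∈ F, ∀ x, |f x| ≤ z := fun f hf x =>
    hz ▸ abs_le_max_abs_abs (hF f hf x).1 (hF f hf x).2
  have hlog : 0 ≤ Real.log (1 / δ) := Real.log_nonneg (by rw [le_div_iff₀ hδ0]; linarith)
  have hexp : Real.exp (-Real.log (1 / δ)) = δ := by
    rw [one_div, Real.log_inv, neg_neg, Real.exp_log hδ0]
  have hR : 0 ≤ rademacherComplexity μ F m :=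
    integral_nonneg fun S => integral_nonneg fun σ => mcera_nonneg hz0 hFz h0 S σ
  have hdev := one_sub_exp_neg_le_measureReal_rademacherComplexity_le (μ := μ)
    hz0 hFz h0 hFmeas hmeas hm hlog
  rw [hexp] at hdev
  exact hdev.trans <| measureReal_mono fun p hp =>
    ⟨hp.trans (le_add_of_nonneg_right (by positivity)),
      add_sqrt_le_of_le_add_sqrt (by positivity) hz0.le hlog (wimpyVariance_nonneg μ F) hR hp⟩
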